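/- Let $S=(N,M_0)$ be a net system, $N=(P,T,F)$ a finite Petri net in which every transition has at least one input place, and $M_0:P\to\mathbb{N}$. A transition $t$ is enabled at $M:P\to\mathbb N$ if $M(p)\ge 1$ for all $p\in{}^\bullet t$, and firing it gives $M-{}^\bullet t+t^\bullet$; the reachable markings are those obtained from $M_0$ by finite (possibly empty) firing sequences. In a net, $x<y$ means that there is a path with at least one arc from $x$ to $y$, and $x\,\#\,y$ (conflict) that some place has two distinct output transitions from which paths (possibly empty) lead to $x$ and to $y$ respectively. An occurrence net $O=(C,E,G)$ (conditions $C$, events $E$) is an acyclic net in which every condition has at most one input event, no node is in conflict with itself, and every node has finitely many nodes below it; $\mathrm{Min}(O)$ is its set of $<$-minimal nodes. A branching process $(O,h)$ of $S$ is an occurrence net $O$ with a map $h$ from conditions to places and from events to transitions that maps ${}^\bullet e$ bijectively onto ${}^\bullet h(e)$ and $e^\bullet$ bijectively onto $h(e)^\bullet$ for each event $e$, such that exactly $M_0(p)$ conditions in $\mathrm{Min}(O)$ have label $p$ for each place $p$, and such that ${}^\bullet e_1={}^\bullet e_2$ and $h(e_1)=h(e_2)$ imply $e_1=e_2$. A prefix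 of a branching process is a subnet that is a branching process under the restricted labelling and that contains the minimal conditions, the input event of each of its conditions, and the input and output conditions of each of its events. The unfolding of $S$ is its maximal branching process, i.e. one that is not isomorphic to a proper prefix of any branching process of $S$. A configuration is a conflict-free set $D$ of events closed under causal predecessors; $[e]=\{x\in E: x<e \text{ or } x=e\}$. For finite $D$, $\mathrm{Cut}(D)=(\mathrm{Min}(O)\cup D^\bullet)\setminus{}^\bullet D$, and $\mathrm{Mark}(D)$ is the marking that assigns to each place $p$ the number of conditions of $\mathrm{Cut}(D)$ labelled $p$. The future of $D$ is the labelled subnet of the nodes that are neither in $D\cup{}^\bullet D$ nor in conflict with an event of $D$. An adequate order $\prec$ is a strict well-founded partial order on the finite configurations of the unfolding such that $D_1\subset D_2$ implies $D_1\prec D_2$, and such that, if $D_1\prec D_2$ and $\mathrm{Mark}(D_1)=\mathrm{Mark}(D_2)$, there is, provided that the futures of $D_1$ and $D_2$ are isomorphic as labelled nets, an isomorphism $I$ from the future of $D_1$ onto that of $D_2$ with $D_1\cup X\prec D_2\cup I(X)$ for every set $X$ of events in the future of $D_1$ for which $D_1\cup X$ and $D_2\cup I(X)$ are finite configurations. An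 event $e$ is a cut-off event if there is another event $e'$ of the unfolding with $\mathrm{Mark}([e'])=\mathrm{Mark}([e])$ and $[e']\prec[e]$. The complete prefix $\pi$ of $S$ (for $\prec$) is the greatest backward closed subnet of the unfolding that contains no event $e$ with $f<e$ for a cut-off event $f$. Claim: for every such $S$, every unfolding of $S$, every adequate order $\prec$ and every reachable marking $M$ of $S$, there is a finite configuration $D$ all of whose events lie in the complete prefix $\pi$, such that $\mathrm{Mark}(D)=M$ and $D$ contains no cut-off event. -/

import Mathlib

namespace PetriUnfolding

universe u₁ u₂ v₁ v₂

/-- A (possibly infinite) net with set of places `P`, set of transitions `T` and flow relation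
`F ⊆ (P × T) ∪ (T × P)`, given by its two parts. -/
structure Net (P : Type u₁) (T : Type u₂) where
  /-- the arcs from places to transitions -/
  inArc : P → T → Prop
  /-- the arcs from transitions to places -/
  outArc : T → P → Prop

namespace Net

variable {P : Type u₁} {T : Type u₂} (N : Net P T)

/-- The preset `•t` of a transition. -/
def pre (t : T) : Set P := {p | N.inArc p t}

/-- The postset `t•` of a transition. -/
def post (t : T) : Set P := {p | N.outArc t p}

/-- The flow relation on the nodes `P ∪ T`. -/
def Arc : P ⊕ T → P ⊕ T → Prop
  | .inl p, .inr t => N.inArc p t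
  | .inr t, .inl p => N.outArc t p
  | _, _ => False

/-- The causal relation `x < y`: there is a path with at least one arc from `x` to `y`. -/
def Causal (x y : P ⊕ T) : Prop := Relation.TransGen N.Arc x y

/-- There is a (possibly empty) path from `x` to `y`. -/
def Path (x y : P ⊕ T) : Prop := Relation.ReflTransGen N.Arc x y

/-- The conflict relation `x # y`: two paths lead from one place `s` to `x` and to `y` and diverge
immediately after `s`. -/
def Conflict (x y : P ⊕ T) : Prop :=
  ∃ (s : P) (t₁ t₂ : T), t₁ ≠ t₂ ∧ N.inArc s t₁ ∧ N.inArc s t₂ ∧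
    N.Path (.inr t₁) x ∧ N.Path (.inr t₂) y

/-- The minimal nodes `Min(N)` with respect to the causal relation. -/
def minNodes : Set (P ⊕ T) := {x | ∀ y, ¬ N.Causal y x}

/-- Occurrence nets: acyclic, at most one input event per condition, no node in conflict with
itself, and finitely many nodes below each node. -/
structure IsOccurrenceNet : Prop where
  acyclic : ∀ x, ¬ N.Causal x x
  pre_subsingleton : ∀ c : P, {e | N.outArc e c}.Subsingleton
  no_self_conflict : ∀ x, ¬ N.Conflict x x
  finite_past : ∀ x, {y | N.Causal y x}.Finite

/-- Configurations: conflict-free and causally closed sets of events. -/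
def IsConfiguration (D : Set T) : Prop :=
  (∀ e ∈ D, ∀ f ∈ D, ¬ N.Conflict (.inr e) (.inr f)) ∧
    ∀ e ∈ D, ∀ f, N.Causal (.inr f) (.inr e) → f ∈ D

/-- The set of places `Cut(D) = (Min ∪ D•) \ •D`. -/
def cut (D : Set T) : Set P :=
  {c | (Sum.inl c ∈ N.minNodes ∨ ∃ e ∈ D, N.outArc e c) ∧ ¬ ∃ e ∈ D, N.inArc c e}

/-- A set of nodes (a subnet) that contains all the predecessors of its nodes. -/
def BackwardClosed (X : Set (P ⊕ T)) : Prop := ∀ x ∈ X, ∀ y, N.Arc y x → y ∈ X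

/-- The nodes of the part of the net that lies beyond the configuration `D`: they are neither in
`D ∪ •D` nor in conflict with an event of `D`. -/
def future (D : Set T) : Set (P ⊕ T) :=
  {x | (∀ e ∈ D, x ≠ .inr e) ∧ (∀ c, (∃ e ∈ D, N.inArc c e) → x ≠ .inl c) ∧
    ∀ e ∈ D, ¬ N.Conflict (.inr e) x}

end Net

/-- A net system: a net with an initial marking. -/
structure NetSystem (P : Type u₁) (T : Type u₂) where
  net : Net P T
  init : P → ℕ

namespace NetSystem

variable {P : Type u₁} {T : Type u₂} (S : NetSystem P T)

/-- `t` is enabled in `M`. -/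
def Enabled (M : P → ℕ) (t : T) : Prop := ∀ p ∈ S.net.pre t, 1 ≤ M p

/-- `M'` is obtained from `M` by firing an enabled transition: `M' = M - •t + t•`. -/
def Step (M M' : P → ℕ) : Prop :=
  ∃ t, S.Enabled M t ∧
    M' = M - (S.net.pre t).indicator 1 + (S.net.post t).indicator 1

/-- `M` is reached from the initial marking by a finite (possibly empty) firing sequence. -/
def Reachable (M : P → ℕ) : Prop := Relation.ReflTransGen S.Step S.init M

end NetSystem

/-- A branching process `(O, h)` of `S`: an occurrence net `O` with conditions `C` and events `E`
and a homomorphism `h` from `O` to `S` that does not identify two events with the same preset. -/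
structure BranchingProcess {P : Type u₁} {T : Type u₂} (S : NetSystem P T)
    (C : Type v₁) (E : Type v₂) where
  net : Net C E
  occ : net.IsOccurrenceNet
  /-- `h` on conditions -/
  hC : C → P
  /-- `h` on events -/
  hE : E → T
  bijOn_pre : ∀ e, Set.BijOn hC (net.pre e) (S.net.pre (hE e))
  bijOn_post : ∀ e, Set.BijOn hC (net.post e) (S.net.post (hE e))
  /-- the minimal conditions represent the initial marking -/
  card_min : ∀ p, {c | Sum.inl c ∈ net.minNodes ∧ hC c = p}.encard = (S.init p : ℕ∞)
  /-- no redundancy -/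
  inj : ∀ e₁ e₂, net.pre e₁ = net.pre e₂ → hE e₁ = hE e₂ → e₁ = e₂

namespace BranchingProcess

variable {P : Type u₁} {T : Type u₂} {S : NetSystem P T} {C : Type v₁} {E : Type v₂}

/-- The maps `fC`, `fE` identify `β` with a prefix of `β'`, i.e. with a subnet of `β'` that
contains the minimal conditions, with each condition its input event, and with each event its
input and output conditions. -/
structure IsPrefixEmbedding {C' : Type v₁} {E' : Type v₂}
    (β : BranchingProcess S C E) (β' : BranchingProcess S C' E')
    (fC : C → C') (fE : E → E') : Prop where
  injC : Function.Injective fC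
  injE : Function.Injective fE
  labelC : ∀ c, β'.hC (fC c) = β.hC c
  labelE : ∀ e, β'.hE (fE e) = β.hE e
  inArc_iff : ∀ c e, β'.net.inArc (fC c) (fE e) ↔ β.net.inArc c e
  outArc_iff : ∀ e c, β'.net.outArc (fE e) (fC c) ↔ β.net.outArc e c
  min_mem : ∀ c', Sum.inl c' ∈ β'.net.minNodes → c' ∈ Set.range fC
  input_mem : ∀ c e', β'.net.outArc e' (fC c) → e' ∈ Set.range fE
  pre_mem : ∀ e c', β'.net.inArc c' (fE e) → c' ∈ Set.range fC
  post_mem : ∀ e c', β'.net.outArc (fE e) c' → c' ∈ Set.range fC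

/-- `β` is the unfolding of `S`: it is a maximal branching process, i.e. it is not a proper prefix
of any branching process of `S`. -/
def IsUnfolding (β : BranchingProcess S C E) : Prop :=
  ∀ (C' : Type v₁) (E' : Type v₂) (β' : BranchingProcess S C' E') (fC : C → C') (fE : E → E'),
    β.IsPrefixEmbedding β' fC fE → Function.Surjective fC ∧ Function.Surjective fE

variable (β : BranchingProcess S C E)

/-- The finite configurations of `β`. -/
def FinConfig : Type v₂ := {D : Set E // D.Finite ∧ β.net.IsConfiguration D}

/-- `Mark(D)`: the marking of `S` represented by `Cut(D)`; for every place it counts the conditions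
of the cut that are labelled by this place. -/
noncomputable def mark (D : Set E) : P → ℕ := fun p => {c | c ∈ β.net.cut D ∧ β.hC c = p}.ncard

/-- The local configuration `[e]` as a set of events. -/
def localEvents (e : E) : Set E := {x | β.net.Causal (.inr x) (.inr e) ∨ x = e}

theorem path_of_mem_localEvents {e x : E} (hx : x ∈ β.localEvents e) :
    β.net.Path (.inr x) (.inr e) := by
  rcases hx with hx | rfl
  · exact Relation.TransGen.to_reflTransGen hx
  · exact Relation.ReflTransGen.refl

theorem localEvents_finite (e : E) : (β.localEvents e).Finite := by
  have h := ((β.occ.finite_past (.inr e)).preimage (Sum.inr_injective.injOn)).union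
    (Set.finite_singleton e)
  exact h.subset fun x hx => hx

theorem localEvents_isConfiguration (e : E) : β.net.IsConfiguration (β.localEvents e) := by
  refine ⟨?_, ?_⟩
  · rintro x hx y hy ⟨s, t₁, t₂, hne, h₁, h₂, p₁, p₂⟩
    exact β.occ.no_self_conflict (.inr e) ⟨s, t₁, t₂, hne, h₁, h₂,
      p₁.trans (β.path_of_mem_localEvents hx), p₂.trans (β.path_of_mem_localEvents hy)⟩
  · intro x hx f hf
    exact Or.inl (Relation.TransGen.trans_left hf (β.path_of_mem_localEvents hx))

/-- The local configuration `[e]`. -/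
def localConfig (e : E) : β.FinConfig :=
  ⟨β.localEvents e, β.localEvents_finite e, β.localEvents_isConfiguration e⟩

/-- An isomorphism between the (labelled) parts of `β` that lie beyond `D₁` and beyond `D₂`. -/
structure FutureIso (D₁ D₂ : Set E) where
  onC : {c : C // Sum.inl c ∈ β.net.future D₁} ≃ {c : C // Sum.inl c ∈ β.net.future D₂}
  onE : {e : E // Sum.inr e ∈ β.net.future D₁} ≃ {e : E // Sum.inr e ∈ β.net.future D₂}
  labelC : ∀ c, β.hC (onC c) = β.hC c
  labelE : ∀ e, β.hE (onE e) = β.hE e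
  inArc_iff : ∀ c e, β.net.inArc (onC c) (onE e) ↔ β.net.inArc c e
  outArc_iff : ∀ e c, β.net.outArc (onE e) (onC c) ↔ β.net.outArc e c

/-- Adequate orders on the finite configurations of `β`: strict well-founded partial orders that
refine strict inclusion and are preserved by finite extensions, i.e. if `D₁ ≺ D₂` and
`Mark(D₁) = Mark(D₂)`, then an isomorphism `I` from the future of `D₁` to the future of `D₂`
satisfies `D₁ ⊕ X ≺ D₂ ⊕ I(X)` for all finite extensions `D₁ ⊕ X` of `D₁`. If a place can carry
several tokens there can be several isomorphisms `I`; only one of them has to have this property.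
The premise `Nonempty` keeps the existence of an isomorphism out of the definition. -/
structure IsAdequate (prec : β.FinConfig → β.FinConfig → Prop) : Prop where
  irrefl : ∀ D, ¬ prec D D
  trans : ∀ D₁ D₂ D₃, prec D₁ D₂ → prec D₂ D₃ → prec D₁ D₃
  wf : WellFounded prec
  of_ssubset : ∀ D₁ D₂ : β.FinConfig, D₁.1 ⊂ D₂.1 → prec D₁ D₂
  of_extension : ∀ D₁ D₂ : β.FinConfig, prec D₁ D₂ → β.mark D₁.1 = β.mark D₂.1 →
    Nonempty (β.FutureIso D₁.1 D₂.1) →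
    ∃ I : β.FutureIso D₁.1 D₂.1,
      ∀ (X : Set {e : E // Sum.inr e ∈ β.net.future D₁.1}) (D₁' D₂' : β.FinConfig),
        D₁'.1 = D₁.1 ∪ Subtype.val '' X →
        D₂'.1 = D₂.1 ∪ Subtype.val '' (I.onE '' X) → prec D₁' D₂'

/-- Cut-off events of `β`. -/
def IsCutoff (prec : β.FinConfig → β.FinConfig → Prop) (e : E) : Prop :=
  ∃ e', e' ≠ e ∧ β.mark (β.localEvents e) = β.mark (β.localEvents e') ∧
    prec (β.localConfig e') (β.localConfig e)

/-- The subnet of `β` with set of nodes `X` is the greatest backward closed subnet of `β` that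
contains no event after any cut-off event. -/
def IsCompletePrefix (prec : β.FinConfig → β.FinConfig → Prop) (X : Set (C ⊕ E)) : Prop :=
  IsGreatest {Y | β.net.BackwardClosed Y ∧
    ∀ e, Sum.inr e ∈ Y → ∀ f, β.IsCutoff prec f → ¬ β.net.Causal (.inr f) (.inr e)} X

end BranchingProcess

end PetriUnfolding

/-! Some finite configuration has marking `M`, because firing sequences lift to the unfolding one
event at a time (`exists_mark_eq`). As `≺` is well-founded, take a `≺`-minimal such configuration
`D`. If `D` contained a cut-off event `e` with companion `e'`, the part of `D` beyond `[e]` could be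
transplanted onto `[e']`. The result has the same marking and is smaller, since `≺` is preserved by
finite extensions: a contradiction (`exists_prec_of_isCutoff`). Free of cut-off events, `D` lies in
the complete prefix (`IsCompletePrefix.inr_mem`).

The transplant needs isomorphic futures for finite configurations with equal markings
(`nonempty_futureIso`). Places may carry several tokens, so there is no canonical matching of the
cuts, but any label-preserving bijection `ρ` extends. It generates `FutureRel`, which relates events
with equal labels and related presets, and then their equally labelled output conditions. This
relation is single-valued both ways because an event is determined by its preset and label, and a
produced condition by its input event and label. It is total by maximality: if an event enabled by
conditions of a cut were missing, the unfolding would be a proper prefix of the process with that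
event added (`exists_event`). -/

namespace PetriUnfolding

universe u₁ u₂ v₁ v₂

/-! ### Configurations, cuts and futures in occurrence nets -/

namespace Net

variable {P : Type u₁} {T : Type u₂} {N : Net P T}

theorem inl_mem_minNodes {c : P} : Sum.inl c ∈ N.minNodes ↔ ∀ e, ¬ N.outArc e c := by
  constructor
  · intro h e he
    exact h (.inr e) (Relation.TransGen.single he)
  · intro h y hy
    obtain ⟨z, -, hz⟩ := Relation.TransGen.tail'_iff.1 hy
    rcases z with z | z
    · exact hz
    · exact h z hz

theorem path_inl {x : P ⊕ T} {c : P} (h : N.Path x (.inl c)) :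
    x = .inl c ∨ ∃ e, N.outArc e c ∧ N.Path x (.inr e) := by
  rcases Relation.ReflTransGen.cases_tail h with h | ⟨z, hz, hzc⟩
  · exact Or.inl h.symm
  · rcases z with z | z
    · exact hzc.elim
    · exact Or.inr ⟨z, hzc, hz⟩

theorem path_inr_inl {f : T} {c : P} (h : N.Path (.inr f) (.inl c)) :
    ∃ e, N.outArc e c ∧ N.Path (.inr f) (.inr e) := by
  rcases path_inl h with h | h
  · cases h
  · exact h

theorem causal_of_arcs {f e : T} {c : P} (h₁ : N.outArc f c) (h₂ : N.inArc c e) :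
    N.Causal (.inr f) (.inr e) :=
  Relation.TransGen.head (b := Sum.inl c) h₁ (Relation.TransGen.single h₂)

theorem mem_of_path_of_closed {D : Set T}
    (hD : ∀ e ∈ D, ∀ c f, N.inArc c e → N.outArc f c → f ∈ D) {f e : T} (he : e ∈ D)
    (h : N.Path (.inr f) (.inr e)) : f ∈ D := by
  -- The path is followed backwards from `e`; at a condition the invariant is that it feeds an event
  -- of `D`.
  have key : ∀ x, N.Path x (.inr e) →
      Sum.elim (fun c => ∃ g ∈ D, N.inArc c g) (fun g => g ∈ D) x := by
    intro x hx
    refine Relation.ReflTransGen.head_induction_on hx ?_ ?_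
    · exact he
    · rintro (a | a) (b | b) hab - ih
      · exact hab.elim
      · exact ⟨b, ih, hab⟩
      · obtain ⟨g, hg, hbg⟩ := ih
        exact hD g hg b a hbg hab
      · exact hab.elim
  exact key _ h

/-- A set of events is a configuration if and only if it is closed under immediate causal
predecessors and no two of its events compete for a condition. -/
theorem isConfiguration_iff {D : Set T} :
    N.IsConfiguration D ↔ (∀ e ∈ D, ∀ c f, N.inArc c e → N.outArc f c → f ∈ D) ∧
      ∀ e ∈ D, ∀ f ∈ D, ∀ c, N.inArc c e → N.inArc c f → e = f := by
  constructor
  · rintro ⟨h₁, h₂⟩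
    refine ⟨fun e he c f hce hfc => h₂ e he f (causal_of_arcs hfc hce), ?_⟩
    intro e he f hf c hce hcf
    by_contra hne
    exact h₁ e he f hf ⟨c, e, f, hne, hce, hcf, .refl, .refl⟩
  · rintro ⟨h₁, h₂⟩
    refine ⟨?_, fun e he f hf => mem_of_path_of_closed h₁ he hf.to_reflTransGen⟩
    rintro e he f hf ⟨s, t₁, t₂, hne, hs₁, hs₂, p₁, p₂⟩
    exact hne (h₂ _ (mem_of_path_of_closed h₁ he p₁) _ (mem_of_path_of_closed h₁ hf p₂) s hs₁ hs₂)

namespace IsConfiguration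

variable {D : Set T}

theorem mem_of_arcs (hD : N.IsConfiguration D) {e f : T} {c : P} (he : e ∈ D)
    (hce : N.inArc c e) (hfc : N.outArc f c) : f ∈ D :=
  (isConfiguration_iff.1 hD).1 e he c f hce hfc

theorem eq_of_inArc (hD : N.IsConfiguration D) {e f : T} {c : P} (he : e ∈ D) (hf : f ∈ D)
    (hce : N.inArc c e) (hcf : N.inArc c f) : e = f :=
  (isConfiguration_iff.1 hD).2 e he f hf c hce hcf

theorem mem_of_path (hD : N.IsConfiguration D) {e f : T} (he : e ∈ D)
    (h : N.Path (.inr f) (.inr e)) : f ∈ D :=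
  mem_of_path_of_closed (isConfiguration_iff.1 hD).1 he h

end IsConfiguration

theorem isConfiguration_empty : N.IsConfiguration ∅ :=
  ⟨fun _ h => h.elim, fun _ h => h.elim⟩

theorem mem_cut_iff {D : Set T} {c : P} : c ∈ N.cut D ↔
    (Sum.inl c ∈ N.minNodes ∨ ∃ e ∈ D, N.outArc e c) ∧ ∀ e ∈ D, ¬ N.inArc c e := by
  simp [cut]

theorem Conflict.trans_path {x y z : P ⊕ T} (h : N.Conflict x y) (hyz : N.Path y z) :
    N.Conflict x z := by
  obtain ⟨s, t₁, t₂, hne, h₁, h₂, p₁, p₂⟩ := h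
  exact ⟨s, t₁, t₂, hne, h₁, h₂, p₁, p₂.trans hyz⟩

/-- Both branches of a conflict start at an event, so the branch ending in a condition is nonempty
and passes through an input event of it. -/
theorem Conflict.exists_of_inl {x : P ⊕ T} {c : P} (h : N.Conflict x (.inl c)) :
    ∃ e, N.outArc e c ∧ N.Conflict x (.inr e) := by
  obtain ⟨s, t₁, t₂, hne, h₁, h₂, p₁, p₂⟩ := h
  obtain ⟨e, he, hp⟩ := path_inr_inl p₂
  exact ⟨e, he, s, t₁, t₂, hne, h₁, h₂, p₁, hp⟩

theorem inr_mem_future {D : Set T} {e : T} :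
    Sum.inr e ∈ N.future D ↔ e ∉ D ∧ ∀ f ∈ D, ¬ N.Conflict (.inr f) (.inr e) := by
  constructor
  · rintro ⟨h₁, -, h₃⟩
    exact ⟨fun h => h₁ e h rfl, h₃⟩
  · rintro ⟨h₁, h₃⟩
    exact ⟨fun f hf h => h₁ (by cases h; exact hf), fun _ _ h => (by cases h), h₃⟩

theorem inl_mem_future {D : Set T} {c : P} :
    Sum.inl c ∈ N.future D ↔
      (∀ e ∈ D, ¬ N.inArc c e) ∧ ∀ f ∈ D, ¬ N.Conflict (.inr f) (.inl c) := by
  constructor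
  · rintro ⟨-, h₂, h₃⟩
    exact ⟨fun e he h => h₂ c ⟨e, he, h⟩ rfl, h₃⟩
  · rintro ⟨h₂, h₃⟩
    refine ⟨fun _ _ h => (by cases h), ?_, h₃⟩
    rintro c' ⟨e, he, h⟩ hc
    cases hc
    exact h₂ e he h

theorem inr_mem_future_of_mem {D D' : Set T} (hD' : N.IsConfiguration D') (hsub : D ⊆ D')
    {e : T} (he : e ∈ D') (heD : e ∉ D) : Sum.inr e ∈ N.future D :=
  inr_mem_future.2 ⟨heD, fun f hf => hD'.1 f (hsub hf) e he⟩

theorem IsConfiguration.inl_mem_future_of_post {D : Set T} (hD : N.IsConfiguration D)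
    (hN : N.IsOccurrenceNet)
    {e : T} {c : P} (he : Sum.inr e ∈ N.future D) (hec : N.outArc e c) :
    Sum.inl c ∈ N.future D := by
  rw [inr_mem_future] at he
  refine inl_mem_future.2 ⟨fun f hf hcf => he.1 (hD.mem_of_arcs hf hcf hec), fun f hf hcf => ?_⟩
  obtain ⟨g, hg, hfg⟩ := hcf.exists_of_inl
  rw [hN.pre_subsingleton c hg hec] at hfg
  exact he.2 f hf hfg

theorem IsConfiguration.inl_mem_future_of_mem_cut {D : Set T} (hD : N.IsConfiguration D)
    (hN : N.IsOccurrenceNet) {c : P} (hc : c ∈ N.cut D) : Sum.inl c ∈ N.future D := by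
  rw [mem_cut_iff] at hc
  refine inl_mem_future.2 ⟨hc.2, fun f hf hcf => ?_⟩
  obtain ⟨g, hg, hfg⟩ := hcf.exists_of_inl
  rcases hc.1 with h | ⟨e, he, hec⟩
  · exact inl_mem_minNodes.1 h g hg
  · rw [hN.pre_subsingleton c hg hec] at hfg
    exact hD.1 f hf e he hfg

theorem inl_mem_future_of_pre {D : Set T} {e : T} {c : P} (he : Sum.inr e ∈ N.future D)
    (hce : N.inArc c e) : Sum.inl c ∈ N.future D := by
  rw [inr_mem_future] at he
  refine inl_mem_future.2 ⟨fun f hf hcf => ?_, fun f hf hcf =>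
    he.2 f hf (hcf.trans_path (Relation.ReflTransGen.single hce))⟩
  refine he.2 f hf ⟨c, f, e, ?_, hcf, hce, .refl, .refl⟩
  rintro rfl
  exact he.1 hf

/-- The input event of a condition beyond `D` lies in `D` or beyond `D`. -/
theorem inr_mem_future_of_outArc {D : Set T} {e : T} {c : P} (hc : Sum.inl c ∈ N.future D)
    (hec : N.outArc e c) (he : e ∉ D) : Sum.inr e ∈ N.future D :=
  inr_mem_future.2 ⟨he, fun f hf h => (inl_mem_future.1 hc).2 f hf
    (h.trans_path (Relation.ReflTransGen.single hec))⟩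

/-- Within the future of `D`, the cut is recognised from the arcs of the future alone: it consists
of the conditions without an input event there. -/
theorem mem_cut_iff_of_mem_future (hN : N.IsOccurrenceNet) {D : Set T} {c : P}
    (hc : Sum.inl c ∈ N.future D) :
    c ∈ N.cut D ↔ ∀ e, Sum.inr e ∈ N.future D → ¬ N.outArc e c := by
  rw [mem_cut_iff]
  constructor
  · rintro ⟨h | ⟨f, hf, hfc⟩, -⟩ e he hec
    · exact inl_mem_minNodes.1 h e hec
    · rw [hN.pre_subsingleton c hec hfc] at he
      exact (inr_mem_future.1 he).1 hf
  · intro h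
    refine ⟨?_, (inl_mem_future.1 hc).1⟩
    by_cases hm : Sum.inl c ∈ N.minNodes
    · exact Or.inl hm
    · rw [inl_mem_minNodes] at hm
      push Not at hm
      obtain ⟨e, he⟩ := hm
      by_cases heD : e ∈ D
      · exact Or.inr ⟨e, heD, he⟩
      · exact (h e (inr_mem_future_of_outArc hc he heD) he).elim

theorem mem_of_path_mem_cut {D : Set T} (hD : N.IsConfiguration D) (hN : N.IsOccurrenceNet)
    {f : T} {c : P} (hc : c ∈ N.cut D) (h : N.Path (.inr f) (.inl c)) : f ∈ D := by
  obtain ⟨g, hg, hfg⟩ := path_inr_inl h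
  rcases (mem_cut_iff.1 hc).1 with h | ⟨e, he, hec⟩
  · exact (inl_mem_minNodes.1 h g hg).elim
  · rw [hN.pre_subsingleton c hg hec] at hfg
    exact hD.mem_of_path he hfg

theorem IsConfiguration.insert_event {D : Set T} (hD : N.IsConfiguration D) (hN : N.IsOccurrenceNet)
    {e : T} (he : N.pre e ⊆ N.cut D) : N.IsConfiguration (insert e D) := by
  rw [isConfiguration_iff]
  constructor
  · rintro x (rfl | hx) c f hcx hfc
    · exact Or.inr (mem_of_path_mem_cut hD hN (he hcx) (Relation.ReflTransGen.single hfc))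
    · exact Or.inr (hD.mem_of_arcs hx hcx hfc)
  · rintro x (rfl | hx) y (rfl | hy) c hcx hcy
    · rfl
    · exact ((mem_cut_iff.1 (he hcx)).2 y hy hcy).elim
    · exact ((mem_cut_iff.1 (he hcy)).2 x hx hcx).elim
    · exact hD.eq_of_inArc hx hy hcx hcy

theorem not_inArc_of_outArc (hN : N.IsOccurrenceNet) {e : T} {c : P} (h : N.outArc e c) :
    ¬ N.inArc c e :=
  fun h' => hN.acyclic _ (causal_of_arcs h h')

theorem cut_insert {D : Set T} (hD : N.IsConfiguration D) (hN : N.IsOccurrenceNet) {e : T}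
    (he : e ∉ D) : N.cut (insert e D) = N.cut D \ N.pre e ∪ N.post e := by
  ext c
  simp only [mem_cut_iff, Set.mem_union, Set.mem_sdiff, Set.mem_insert_iff, pre, post,
    Set.mem_ofPred_eq, forall_eq_or_imp, exists_eq_or_imp]
  constructor
  · rintro ⟨h | h | h, h₁, h₂⟩
    · exact Or.inl ⟨⟨Or.inl h, h₂⟩, h₁⟩
    · exact Or.inr h
    · exact Or.inl ⟨⟨Or.inr h, h₂⟩, h₁⟩
  · rintro (⟨⟨h | h, h₂⟩, h₁⟩ | h)
    · exact ⟨Or.inl h, h₁, h₂⟩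
    · exact ⟨Or.inr (Or.inr h), h₁, h₂⟩
    -- An output condition of `e` is not consumed by `D`: its consumer would force `e` into the
    -- causally closed set `D`.
    · exact ⟨Or.inr (Or.inl h), not_inArc_of_outArc hN h,
        fun f hf hcf => he (hD.mem_of_arcs hf hcf h)⟩

theorem disjoint_cut_post {D : Set T} (hN : N.IsOccurrenceNet) {e : T}
    (he : e ∉ D) : Disjoint (N.cut D) (N.post e) := by
  rw [Set.disjoint_left]
  intro c hc hec
  rcases (mem_cut_iff.1 hc).1 with h | ⟨f, hf, hfc⟩
  · exact inl_mem_minNodes.1 h e hec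
  · rw [hN.pre_subsingleton c hfc hec] at hf
    exact he hf

/-- Every finite configuration that properly contains a configuration `D` arises from a configuration
containing `D` by adding one event. -/
theorem IsConfiguration.exists_eq_insert {D D' : Set T} (hD' : N.IsConfiguration D')
    (hN : N.IsOccurrenceNet) (hfin : D'.Finite) (hD : N.IsConfiguration D) (hss : D ⊂ D') :
    ∃ D₀ e, N.IsConfiguration D₀ ∧ D ⊆ D₀ ∧ e ∉ D₀ ∧ N.pre e ⊆ N.cut D₀ ∧ D' = insert e D₀ := by
  -- An event with the most causal predecessors is causally maximal in `D'`: anything above it in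
  -- `D'` is also outside `D` and has strictly more predecessors.
  obtain ⟨e, ⟨heD', heD⟩, hmax⟩ := Set.exists_max_image (D' \ D)
    (fun e => {y | N.Causal y (.inr e)}.ncard) (hfin.subset Set.sdiff_subset)
    (Set.nonempty_of_ssubset hss)
  have hno : ∀ f ∈ D', ¬ N.Causal (.inr e) (.inr f) := by
    intro f hf hef
    have hfD : f ∉ D := fun h => heD (hD.2 f h e hef)
    refine (hmax f ⟨hf, hfD⟩).not_gt (Set.ncard_lt_ncard ?_ (hN.finite_past _))
    refine ⟨fun y hy => Relation.TransGen.trans hy hef, fun h => ?_⟩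
    exact hN.acyclic _ (h hef)
  refine ⟨D' \ {e}, e, ?_, fun x hx => ⟨hss.1 hx, ?_⟩, fun h => h.2 rfl, ?_, ?_⟩
  · refine ⟨fun x hx y hy => hD'.1 x hx.1 y hy.1, fun x hx y hyx => ⟨hD'.2 x hx.1 y hyx, ?_⟩⟩
    rintro rfl
    exact hno x hx.1 hyx
  · rintro rfl
    exact heD hx
  · intro c hc
    rw [mem_cut_iff]
    constructor
    · by_cases hm : Sum.inl c ∈ N.minNodes
      · exact Or.inl hm
      · rw [inl_mem_minNodes] at hm
        push Not at hm
        obtain ⟨f, hf⟩ := hm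
        refine Or.inr ⟨f, ⟨hD'.mem_of_arcs heD' hc hf, ?_⟩, hf⟩
        rintro rfl
        exact not_inArc_of_outArc hN hf hc
    · rintro f ⟨hf, hfe⟩ hcf
      exact hfe (hD'.eq_of_inArc hf heD' hcf hc)
  · rw [Set.insert_sdiff_singleton, Set.insert_eq_of_mem heD']

/-- The smallest configuration that contains `D` and an event beyond `D`. -/
theorem IsConfiguration.union_past {D : Set T} (hD : N.IsConfiguration D)
    (hN : N.IsOccurrenceNet) {e : T} (he : Sum.inr e ∈ N.future D) :
    N.IsConfiguration (D ∪ {f | N.Path (.inr f) (.inr e)}) := by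
  rw [inr_mem_future] at he
  rw [isConfiguration_iff]
  constructor
  · rintro x (hx | hx) c f hcx hfc
    · exact Or.inl (hD.mem_of_arcs hx hcx hfc)
    · exact Or.inr ((causal_of_arcs hfc hcx).to_reflTransGen.trans hx)
  · rintro x (hx | hx) y (hy | hy) c hcx hcy
    · exact hD.eq_of_inArc hx hy hcx hcy
    · by_contra hne
      exact he.2 x hx ⟨c, x, y, hne, hcx, hcy, .refl, hy⟩
    · by_contra hne
      exact he.2 y hy ⟨c, y, x, Ne.symm hne, hcy, hcx, .refl, hx⟩
    · by_contra hne
      exact hN.no_self_conflict _ ⟨c, x, y, hne, hcx, hcy, hx, hy⟩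

end Net

/-! ### Adding one event to an occurrence net -/

namespace Net

variable {P : Type u₁} {T : Type u₂}

/-- The net `N` with one additional transition, whose preset is `B` and whose postset consists of
new places indexed by `K`. -/
def addEvent (N : Net P T) (B : Set P) (K : Type v₁) : Net (P ⊕ K) (Option T) where
  inArc
    | .inl c, some e => N.inArc c e
    | .inl c, none => c ∈ B
    | .inr _, _ => False
  outArc
    | some e, .inl c => N.outArc e c
    | none, .inr _ => True
    | _, _ => False

/-- The inclusion of the nodes of `N` into the nodes of `N.addEvent B K`. -/
def oldNode (K : Type v₁) : P ⊕ T → (P ⊕ K) ⊕ Option T := Sum.map Sum.inl some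

variable {N : Net P T} {B : Set P} {K : Type v₁}

/-- The new event feeds only new conditions, and these feed nothing, so the past of an old node does
not change. -/
theorem arc_addEvent_oldNode {y : (P ⊕ K) ⊕ Option T} {x : P ⊕ T}
    (h : (N.addEvent B K).Arc y (oldNode K x)) : ∃ y₀, y = oldNode K y₀ ∧ N.Arc y₀ x := by
  rcases x with x | x <;> rcases y with (y | y) | (_ | y)
  · exact h.elim
  · exact h.elim
  · exact h.elim
  · exact ⟨.inr y, rfl, h⟩
  · exact ⟨.inl y, rfl, h⟩
  · exact h.elim
  · exact h.elim
  · exact h.elim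

theorem path_addEvent_oldNode {y : (P ⊕ K) ⊕ Option T} {x : P ⊕ T}
    (h : (N.addEvent B K).Path y (oldNode K x)) : ∃ y₀, y = oldNode K y₀ ∧ N.Path y₀ x := by
  refine Relation.ReflTransGen.head_induction_on h ⟨x, rfl, .refl⟩ ?_
  rintro a b hab - ⟨b₀, rfl, hb⟩
  obtain ⟨a₀, rfl, ha⟩ := arc_addEvent_oldNode hab
  exact ⟨a₀, rfl, .head ha hb⟩

theorem causal_addEvent_oldNode {y : (P ⊕ K) ⊕ Option T} {x : P ⊕ T}
    (h : (N.addEvent B K).Causal y (oldNode K x)) : ∃ y₀, y = oldNode K y₀ ∧ N.Causal y₀ x := by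
  obtain ⟨z, hz, hzx⟩ := Relation.TransGen.head'_iff.1 h
  obtain ⟨z₀, rfl, hz₀⟩ := path_addEvent_oldNode hzx
  obtain ⟨y₀, rfl, hy₀⟩ := arc_addEvent_oldNode hz
  exact ⟨y₀, rfl, Relation.TransGen.head'_iff.2 ⟨z₀, hy₀, hz₀⟩⟩

theorem causal_addEvent_new {y : (P ⊕ K) ⊕ Option T}
    (h : (N.addEvent B K).Causal y (.inr none)) :
    ∃ b ∈ B, ∃ y₀, y = oldNode K y₀ ∧ N.Path y₀ (.inl b) := by
  obtain ⟨z, hyz, hz⟩ := Relation.TransGen.tail'_iff.1 h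
  rcases z with (b | z) | z
  · exact ⟨b, hz, path_addEvent_oldNode (x := .inl b) hyz⟩
  · exact hz.elim
  · exact hz.elim

theorem path_addEvent_newPlace {y : (P ⊕ K) ⊕ Option T} {k : K}
    (h : (N.addEvent B K).Path y (.inl (.inr k))) :
    y = .inl (.inr k) ∨ (N.addEvent B K).Path y (.inr none) := by
  rcases path_inl h with h | ⟨e | e, he, hp⟩
  · exact Or.inl h
  · exact Or.inr hp
  · exact he.elim

/-- The events strictly below the new one lie in the conflict-free set `D`, and none of them
consumes a condition of `B`, which is still in the cut. -/
theorem not_conflict_addEvent_new (hN : N.IsOccurrenceNet) {D : Set T}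
    (hD : N.IsConfiguration D) (hB : B ⊆ N.cut D) :
    ¬ (N.addEvent B K).Conflict (.inr none) (.inr none) := by
  have key : ∀ t, (N.addEvent B K).Path (.inr t) (.inr none) →
      t = none ∨ ∃ t₀ ∈ D, t = some t₀ := by
    intro t ht
    rcases Relation.reflTransGen_iff_eq_or_transGen.1 ht with h | h
    · cases h
      exact Or.inl rfl
    · obtain ⟨b, hb, y₀, hy, hp⟩ := causal_addEvent_new h
      rcases y₀ with y₀ | y₀ <;> cases hy
      exact Or.inr ⟨y₀, mem_of_path_mem_cut hD hN (hB hb) hp, rfl⟩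
  rintro ⟨s | s, t₁, t₂, hne, h₁, h₂, p₁, p₂⟩
  · rcases key t₁ p₁ with rfl | ⟨e₁, he₁, rfl⟩ <;> rcases key t₂ p₂ with rfl | ⟨e₂, he₂, rfl⟩
    · exact hne rfl
    · exact (mem_cut_iff.1 (hB h₁)).2 e₂ he₂ h₂
    · exact (mem_cut_iff.1 (hB h₂)).2 e₁ he₁ h₁
    · exact hne (congrArg some (hD.eq_of_inArc he₁ he₂ h₁ h₂))
  · exact h₁

theorem isOccurrenceNet_addEvent (hN : N.IsOccurrenceNet) {D : Set T}
    (hD : N.IsConfiguration D) (hB : B ⊆ N.cut D) (hfin : B.Finite) :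
    (N.addEvent B K).IsOccurrenceNet := by
  have causal_place : ∀ y k, (N.addEvent B K).Causal y (.inl (.inr k)) →
      (N.addEvent B K).Path y (.inr none) := by
    intro y k h
    obtain ⟨z, hyz, hz⟩ := Relation.TransGen.tail'_iff.1 h
    rcases z with z | _ | z
    · exact hz.elim
    · exact hyz
    · exact hz.elim
  have acyclic_new : ¬ (N.addEvent B K).Causal (.inr none) (.inr none) := by
    intro h
    obtain ⟨b, -, y₀, hy, -⟩ := causal_addEvent_new h
    rcases y₀ with y₀ | y₀ <;> cases hy
  have finite_new : {y | (N.addEvent B K).Causal y (.inr none)}.Finite := by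
    refine Set.Finite.subset (hfin.biUnion fun b _ =>
      (((hN.finite_past (.inl b)).union (Set.finite_singleton (.inl b))).image (oldNode K))) ?_
    intro y hy
    obtain ⟨b, hb, y₀, rfl, hp⟩ := causal_addEvent_new hy
    refine Set.mem_biUnion hb ⟨y₀, ?_, rfl⟩
    rcases Relation.reflTransGen_iff_eq_or_transGen.1 hp with h | h
    · exact Or.inr h.symm
    · exact Or.inl h
  have conflict_old : ∀ x, ¬ (N.addEvent B K).Conflict (oldNode K x) (oldNode K x) := by
    rintro x ⟨s | s, t₁, t₂, hne, h₁, h₂, p₁, p₂⟩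
    · obtain ⟨y₁, hy₁, q₁⟩ := path_addEvent_oldNode p₁
      obtain ⟨y₂, hy₂, q₂⟩ := path_addEvent_oldNode p₂
      rcases y₁ with y₁ | y₁ <;> cases hy₁
      rcases y₂ with y₂ | y₂ <;> cases hy₂
      exact hN.no_self_conflict x ⟨s, y₁, y₂, fun h => hne (congrArg some h), h₁, h₂, q₁, q₂⟩
    · exact h₁
  refine ⟨?_, ?_, ?_, ?_⟩
  · have old : ∀ x, ¬ (N.addEvent B K).Causal (oldNode K x) (oldNode K x) := by
      intro x h
      obtain ⟨y, hy, hp⟩ := causal_addEvent_oldNode h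
      have : x = y := (Sum.map_injective.2 ⟨Sum.inl_injective, Option.some_injective _⟩) hy
      exact hN.acyclic x (by rwa [← this] at hp)
    rintro ((c | k) | _ | e)
    · exact old (.inl c)
    · intro h
      -- A cycle through a new condition passes through its only input event, the new event, whose
      -- past is already known to be acyclic.
      refine acyclic_new (Relation.TransGen.head' (b := .inl (.inr k)) ?_ (causal_place _ k h))
      exact trivial
    · exact acyclic_new
    · exact old (.inr e)
  · rintro (c | k) (_ | e) he (_ | f) hf
    · rfl
    · exact he.elim
    · exact hf.elim
    · exact congrArg some (hN.pre_subsingleton c he hf)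
    · rfl
    · exact hf.elim
    · exact he.elim
    · exact he.elim
  · rintro ((c | k) | _ | e)
    · exact conflict_old (.inl c)
    · rintro ⟨s, t₁, t₂, hne, h₁, h₂, p₁, p₂⟩
      rcases path_addEvent_newPlace p₁ with h | p₁
      · cases h
      rcases path_addEvent_newPlace p₂ with h | p₂
      · cases h
      exact not_conflict_addEvent_new hN hD hB ⟨s, t₁, t₂, hne, h₁, h₂, p₁, p₂⟩
    · exact not_conflict_addEvent_new hN hD hB
    · exact conflict_old (.inr e)
  · have old : ∀ x, {y | (N.addEvent B K).Causal y (oldNode K x)}.Finite := by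
      intro x
      refine ((hN.finite_past x).image (oldNode K)).subset ?_
      intro y hy
      obtain ⟨y₀, rfl, h⟩ := causal_addEvent_oldNode hy
      exact ⟨y₀, h, rfl⟩
    rintro ((c | k) | _ | e)
    · exact old (.inl c)
    · refine (finite_new.union (Set.finite_singleton (.inr none))).subset ?_
      intro y hy
      rcases Relation.reflTransGen_iff_eq_or_transGen.1 (causal_place y k hy) with h | h
      · exact Or.inr h.symm
      · exact Or.inl h
    · exact finite_new
    · exact old (.inr e)

end Net

/-! ### Maximality: enabled transitions occur in the unfolding -/

namespace BranchingProcess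

variable {P : Type u₁} {T : Type u₂} {S : NetSystem P T} {C : Type v₁} {E : Type v₂}

theorem bijOn_sumElim_inl {X Y Z : Type*} {f : X → Z} (g : Y → Z) {A : Set X} {Q : Set Z}
    (h : Set.BijOn f A Q) : Set.BijOn (Sum.elim f g) (Sum.inl '' A) Q := by
  refine ⟨?_, ?_, ?_⟩
  · rintro _ ⟨a, ha, rfl⟩
    exact h.mapsTo ha
  · rintro _ ⟨a, ha, rfl⟩ _ ⟨b, hb, rfl⟩ hab
    exact congrArg Sum.inl (h.injOn ha hb hab)
  · intro q hq
    obtain ⟨a, ha, rfl⟩ := h.surjOn hq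
    exact ⟨_, ⟨a, ha, rfl⟩, rfl⟩

/-- The branching process `β` with one additional event labelled `t`. -/
def addEvent (β : BranchingProcess S C E) {D : Set E} (hD : β.net.IsConfiguration D) (t : T)
    {B : Set C} (hB : B ⊆ β.net.cut D) (hfin : B.Finite) (hBt : Set.BijOn β.hC B (S.net.pre t))
    {K : Type v₁} (k : K → P) (hk : Set.BijOn k Set.univ (S.net.post t))
    (hnew : ∀ e, β.net.pre e = B → β.hE e ≠ t) : BranchingProcess S (C ⊕ K) (Option E) where
  net := β.net.addEvent B K
  occ := Net.isOccurrenceNet_addEvent β.occ hD hB hfin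
  hC := Sum.elim β.hC k
  hE e := e.elim t β.hE
  bijOn_pre e := by
    rcases e with _ | e
    · convert bijOn_sumElim_inl k hBt using 1
      · ext (c | c) <;> simp [Net.pre, Net.addEvent]
      · rfl
    · convert bijOn_sumElim_inl k (β.bijOn_pre e) using 1
      · ext (c | c) <;> simp [Net.pre, Net.addEvent]
      · rfl
  bijOn_post e := by
    rcases e with _ | e
    · have h := bijOn_sumElim_inl β.hC hk
      refine ⟨?_, ?_, ?_⟩
      · rintro (c | c) hc
        · exact hc.elim
        · exact hk.mapsTo (Set.mem_univ c)
      · rintro (c | c) hc (d | d) hd hcd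
        · exact hc.elim
        · exact hc.elim
        · exact hd.elim
        · exact congrArg Sum.inr (hk.injOn (Set.mem_univ c) (Set.mem_univ d) hcd)
      · intro p hp
        obtain ⟨c, -, rfl⟩ := hk.surjOn hp
        exact ⟨.inr c, trivial, rfl⟩
    · convert bijOn_sumElim_inl k (β.bijOn_post e) using 1
      · ext (c | c) <;> simp [Net.post, Net.addEvent]
      · rfl
  card_min p := by
    rw [← β.card_min p, ← Sum.inl_injective.encard_image (β := C ⊕ K)]
    congr 1
    ext (c | c)
    · simp [Net.inl_mem_minNodes, Net.addEvent, Option.forall]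
    · simp [Net.inl_mem_minNodes, Net.addEvent, Option.forall]
  inj := by
    have hsome : ∀ e, Sum.inl ⁻¹' (β.net.addEvent B K).pre (some e) = β.net.pre e := fun _ => rfl
    have hnone : Sum.inl ⁻¹' (β.net.addEvent B K).pre none = B := rfl
    rintro (_ | e₁) (_ | e₂) hpre hlab
    · rfl
    · exact (hnew e₂ (by rw [← hsome, ← hpre, hnone]) hlab.symm).elim
    · exact (hnew e₁ (by rw [← hsome, hpre, hnone]) hlab).elim
    · exact congrArg some (β.inj e₁ e₂ (by rw [← hsome, hpre, hsome]) hlab)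

theorem isPrefixEmbedding_addEvent (β : BranchingProcess S C E) {D : Set E}
    (hD : β.net.IsConfiguration D) (t : T)
    {B : Set C} (hB : B ⊆ β.net.cut D) (hfin : B.Finite) (hBt : Set.BijOn β.hC B (S.net.pre t))
    {K : Type v₁} (k : K → P) (hk : Set.BijOn k Set.univ (S.net.post t))
    (hnew : ∀ e, β.net.pre e = B → β.hE e ≠ t) :
    β.IsPrefixEmbedding (β.addEvent hD t hB hfin hBt k hk hnew) Sum.inl some where
  injC := Sum.inl_injective
  injE := Option.some_injective _
  labelC _ := rfl
  labelE _ := rfl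
  inArc_iff _ _ := Iff.rfl
  outArc_iff _ _ := Iff.rfl
  min_mem := by
    rintro (c | c) hc
    · exact ⟨c, rfl⟩
    · exact (Net.inl_mem_minNodes.1 hc none trivial).elim
  input_mem := by
    rintro c (_ | e) he
    · exact he.elim
    · exact ⟨e, rfl⟩
  pre_mem := by
    rintro e (c | c) hc
    · exact ⟨c, rfl⟩
    · exact hc.elim
  post_mem := by
    rintro e (c | c) hc
    · exact ⟨c, rfl⟩
    · exact hc.elim

/-- In the unfolding every transition that is enabled by conditions of a cut occurs. -/
theorem IsUnfolding.exists_event [Finite P] {β : BranchingProcess S C E} (hβ : β.IsUnfolding)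
    {D : Set E} (hD : β.net.IsConfiguration D) {t : T} {B : Set C} (hB : B ⊆ β.net.cut D)
    (hBt : Set.BijOn β.hC B (S.net.pre t)) : ∃ e, β.net.pre e = B ∧ β.hE e = t := by
  by_contra hno
  push Not at hno
  have hfin : B.Finite := hBt.finite_iff_finite.2 (Set.toFinite _)
  -- Maximality only concerns processes whose conditions live in the universe of `C`, so the new
  -- conditions are indexed by a copy of the finite postset in that universe.
  let k : Shrink.{v₁} (S.net.post t) → P := fun x => ((equivShrink _).symm x : S.net.post t)
  have hk : Set.BijOn k Set.univ (S.net.post t) := by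
    refine ⟨fun x _ => Subtype.coe_prop _, ?_, ?_⟩
    · exact (Subtype.val_injective.comp (equivShrink _).symm.injective).injOn
    · intro p hp
      exact ⟨equivShrink _ ⟨p, hp⟩, Set.mem_univ _, by simp [k]⟩
  obtain ⟨e, he⟩ := (hβ _ _ _ _ _ (β.isPrefixEmbedding_addEvent hD t hB hfin hBt k hk hno)).2 none
  cases he

end BranchingProcess

/-! ### Markings of configurations -/

namespace BranchingProcess

variable {P : Type u₁} {T : Type u₂} {S : NetSystem P T} {C : Type v₁} {E : Type v₂}

theorem ncard_fiber_of_bijOn {X Z : Type*} {f : X → Z} {A : Set X} {Q : Set Z}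
    (h : Set.BijOn f A Q) (p : Z) : {c | c ∈ A ∧ f c = p}.ncard = Q.indicator 1 p := by
  by_cases hp : p ∈ Q
  · obtain ⟨a, ha, rfl⟩ := h.surjOn hp
    rw [Set.indicator_of_mem hp, Pi.one_apply, Set.ncard_eq_one]
    refine ⟨a, Set.ext fun c => ⟨fun hc => h.injOn hc.1 ha hc.2, ?_⟩⟩
    rintro rfl
    exact ⟨ha, rfl⟩
  · rw [Set.indicator_of_notMem hp]
    convert Set.ncard_empty X
    refine Set.eq_empty_of_forall_notMem fun c hc => hp ?_
    rw [← hc.2]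
    exact h.mapsTo hc.1

theorem finite_min [Finite P] (β : BranchingProcess S C E) :
    {c | Sum.inl c ∈ β.net.minNodes}.Finite := by
  refine (Set.finite_iUnion fun p => Set.finite_of_encard_eq_coe (β.card_min p)).subset ?_
  intro c hc
  exact Set.mem_iUnion.2 ⟨β.hC c, hc, rfl⟩

/-- `mark` counts with `ncard`, which is `0` on infinite sets; finiteness of cuts makes these counts
meaningful. -/
theorem finite_cut [Finite P] (β : BranchingProcess S C E) {D : Set E} (hD : D.Finite) :
    (β.net.cut D).Finite := by
  refine (β.finite_min.union (hD.biUnion fun e _ =>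
    (β.bijOn_post e).finite_iff_finite.2 (Set.toFinite _))).subset ?_
  rintro c ⟨hc | ⟨e, he, hec⟩, -⟩
  · exact Or.inl hc
  · exact Or.inr (Set.mem_biUnion he hec)

theorem mark_empty (β : BranchingProcess S C E) : β.mark ∅ = S.init := by
  funext p
  have h := congrArg ENat.toNat (β.card_min p)
  rw [ENat.toNat_natCast] at h
  rw [← h, mark, Set.ncard]
  congr 2
  ext c
  simp [Net.mem_cut_iff]

/-- The cut loses the preset of `e` and gains its disjoint postset. As the preset lies in the cut,
the truncated subtraction is exact. -/
theorem mark_insert [Finite P] (β : BranchingProcess S C E) {D : Set E} (hfin : D.Finite)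
    (hD : β.net.IsConfiguration D) {e : E} (he : e ∉ D) (hpre : β.net.pre e ⊆ β.net.cut D) :
    β.mark (insert e D) = β.mark D - (S.net.pre (β.hE e)).indicator 1 +
      (S.net.post (β.hE e)).indicator 1 := by
  funext p
  rw [Pi.add_apply, Pi.sub_apply, ← ncard_fiber_of_bijOn (β.bijOn_pre e),
    ← ncard_fiber_of_bijOn (β.bijOn_post e)]
  have hcut : {c | c ∈ β.net.cut D ∧ β.hC c = p}.Finite :=
    (β.finite_cut hfin).subset fun c hc => hc.1
  have hsub : {c | c ∈ β.net.pre e ∧ β.hC c = p} ⊆ {c | c ∈ β.net.cut D ∧ β.hC c = p} :=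
    fun c hc => ⟨hpre hc.1, hc.2⟩
  have hpost : {c | c ∈ β.net.post e ∧ β.hC c = p}.Finite :=
    ((β.bijOn_post e).finite_iff_finite.2 (Set.toFinite _)).subset fun c hc => hc.1
  rw [mark, mark, ← Set.ncard_sdiff hsub (hcut.subset hsub), ← Set.ncard_union_eq ?_ hcut.sdiff hpost]
  · congr 1
    ext c
    rw [Net.cut_insert hD β.occ he]
    simp only [Set.mem_ofPred_eq, Set.mem_union, Set.mem_sdiff]
    tauto
  · exact (Net.disjoint_cut_post β.occ he).mono (fun c hc => hc.1.1) fun c hc => hc.1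

/-- Events of `D` have consumed their presets. An empty preset would lie in every cut, and
irredundancy allows no second copy of such an event; hence the assumption on input places. -/
theorem notMem_of_pre_subset_cut (β : BranchingProcess S C E) {D : Set E} {e : E}
    (hne : (S.net.pre (β.hE e)).Nonempty) (hpre : β.net.pre e ⊆ β.net.cut D) : e ∉ D := by
  intro he
  obtain ⟨p, hp⟩ := hne
  obtain ⟨c, hc, -⟩ := (β.bijOn_pre e).surjOn hp
  exact (Net.mem_cut_iff.1 (hpre hc)).2 e he hc

/-- Every reachable marking is represented in the unfolding by a finite configuration. -/
theorem IsUnfolding.exists_mark_eq [Finite P] (hpre : ∀ t, (S.net.pre t).Nonempty)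
    {β : BranchingProcess S C E} (hβ : β.IsUnfolding) {M : P → ℕ} (hM : S.Reachable M) :
    ∃ D : Set E, D.Finite ∧ β.net.IsConfiguration D ∧ β.mark D = M := by
  induction hM with
  | refl => exact ⟨∅, Set.finite_empty, Net.isConfiguration_empty, β.mark_empty⟩
  | tail _ hstep ih =>
    obtain ⟨D, hfin, hD, rfl⟩ := ih
    obtain ⟨t, ht, rfl⟩ := hstep
    -- Enabledness puts a condition of each input place in the cut; any choice of one per place is
    -- the preset of an event labelled `t`.
    have hex : ∀ p : S.net.pre t, ∃ c, c ∈ β.net.cut D ∧ β.hC c = p := fun p =>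
      Set.nonempty_of_ncard_ne_zero (s := {c | c ∈ β.net.cut D ∧ β.hC c = p})
        (Nat.one_le_iff_ne_zero.1 (ht p p.2))
    choose g hg hgp using hex
    have hB : Set.range g ⊆ β.net.cut D := by
      rintro _ ⟨p, rfl⟩
      exact hg p
    have hBt : Set.BijOn β.hC (Set.range g) (S.net.pre t) := by
      refine ⟨?_, ?_, fun p hp => ⟨g ⟨p, hp⟩, ⟨_, rfl⟩, hgp _⟩⟩
      · rintro _ ⟨p, rfl⟩
        rw [hgp]
        exact p.2
      · rintro _ ⟨p, rfl⟩ _ ⟨q, rfl⟩ h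
        rw [hgp, hgp] at h
        rw [Subtype.ext h]
    obtain ⟨e, he, rfl⟩ := hβ.exists_event hD hB hBt
    rw [← he] at hB
    exact ⟨insert e D, hfin.insert e, hD.insert_event β.occ hB,
      β.mark_insert hfin hD (β.notMem_of_pre_subset_cut (hpre _) hB) hB⟩

/-! ### Transport along isomorphisms of futures -/

namespace FutureIso

variable {β : BranchingProcess S C E} {D₁ D₂ : Set E}

/-- The inverse isomorphism. -/
def symm (I : β.FutureIso D₁ D₂) : β.FutureIso D₂ D₁ where
  onC := I.onC.symm
  onE := I.onE.symm
  labelC c := by rw [← I.labelC, Equiv.apply_symm_apply]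
  labelE e := by rw [← I.labelE, Equiv.apply_symm_apply]
  inArc_iff c e := by rw [← I.inArc_iff, Equiv.apply_symm_apply, Equiv.apply_symm_apply]
  outArc_iff e c := by rw [← I.outArc_iff, Equiv.apply_symm_apply, Equiv.apply_symm_apply]

/-- Presets of future events stay in the future, so causal closure and competition within `X` can be
tested on its image; events of `D₁` share no input condition with future events. -/
theorem isConfiguration_union (I : β.FutureIso D₁ D₂) (h₁ : β.net.IsConfiguration D₁)
    {X : Set {e : E // Sum.inr e ∈ β.net.future D₁}}
    (h : β.net.IsConfiguration (D₂ ∪ Subtype.val '' (I.onE '' X))) :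
    β.net.IsConfiguration (D₁ ∪ Subtype.val '' X) := by
  have hmem : ∀ {x}, x ∈ X → ((I.onE x : E) ∈ D₂ ∪ Subtype.val '' (I.onE '' X)) := fun {x} hx =>
    Or.inr ⟨_, ⟨x, hx, rfl⟩, rfl⟩
  rw [Net.isConfiguration_iff]
  constructor
  · rintro e (he | ⟨e, he, rfl⟩) c f hce hfc
    · exact Or.inl (h₁.mem_of_arcs he hce hfc)
    · by_cases hf : f ∈ D₁
      · exact Or.inl hf
      · have hc := Net.inl_mem_future_of_pre e.2 hce
        have hf' := Net.inr_mem_future_of_outArc hc hfc hf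
        rcases h.mem_of_arcs (hmem he) ((I.inArc_iff ⟨c, hc⟩ e).2 hce)
          ((I.outArc_iff ⟨f, hf'⟩ ⟨c, hc⟩).2 hfc) with h | ⟨_, ⟨x, hx, rfl⟩, hxf⟩
        · exact ((Net.inr_mem_future.1 (I.onE ⟨f, hf'⟩).2).1 h).elim
        · have := I.onE.injective (Subtype.ext hxf)
          exact Or.inr ⟨x, hx, by rw [this]⟩
  · have mixed : ∀ e ∈ D₁, ∀ f : {e : E // Sum.inr e ∈ β.net.future D₁}, ∀ c,
        β.net.inArc c e → ¬ β.net.inArc c f := fun e he f c hce hcf =>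
      (Net.inl_mem_future.1 (Net.inl_mem_future_of_pre f.2 hcf)).1 e he hce
    rintro e (he | ⟨e, he, rfl⟩) f (hf | ⟨f, hf, rfl⟩) c hce hcf
    · exact h₁.eq_of_inArc he hf hce hcf
    · exact (mixed e he f c hce hcf).elim
    · exact (mixed f hf e c hcf hce).elim
    · have hc := Net.inl_mem_future_of_pre e.2 hce
      have := h.eq_of_inArc (hmem he) (hmem hf) ((I.inArc_iff ⟨c, hc⟩ e).2 hce)
        ((I.inArc_iff ⟨c, hc⟩ f).2 hcf)
      rw [I.onE.injective (Subtype.ext this)]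

/-- The right-hand side mentions only nodes and arcs of the future of `D₁`, hence is invariant under
isomorphisms of futures. -/
theorem mem_cut_union_iff (h₁ : β.net.IsConfiguration D₁)
    {X : Set {e : E // Sum.inr e ∈ β.net.future D₁}} {c : C} :
    c ∈ β.net.cut (D₁ ∪ Subtype.val '' X) ↔ ∃ _ : Sum.inl c ∈ β.net.future D₁,
      ((∀ e : {e : E // Sum.inr e ∈ β.net.future D₁}, ¬ β.net.outArc e c) ∨
        ∃ e ∈ X, β.net.outArc e c) ∧ ∀ e ∈ X, ¬ β.net.inArc c e := by
  constructor
  · intro h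
    obtain ⟨hout, hin⟩ := Net.mem_cut_iff.1 h
    have hin₁ : ∀ e ∈ D₁, ¬ β.net.inArc c e := fun e he => hin e (Or.inl he)
    have hin₂ : ∀ e ∈ X, ¬ β.net.inArc c e := fun e he => hin e (Or.inr ⟨e, he, rfl⟩)
    have of_cut : c ∈ β.net.cut D₁ → ∃ _ : Sum.inl c ∈ β.net.future D₁,
      ((∀ e : {e : E // Sum.inr e ∈ β.net.future D₁}, ¬ β.net.outArc e c) ∨
        ∃ e ∈ X, β.net.outArc e c) ∧ ∀ e ∈ X, ¬ β.net.inArc c e := fun hc =>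
      have hc' := h₁.inl_mem_future_of_mem_cut β.occ hc
      ⟨hc', Or.inl fun e => (Net.mem_cut_iff_of_mem_future β.occ hc').1 hc e e.2, hin₂⟩
    rcases hout with hm | ⟨e, he | ⟨e, he, rfl⟩, hec⟩
    · exact of_cut (Net.mem_cut_iff.2 ⟨Or.inl hm, hin₁⟩)
    · exact of_cut (Net.mem_cut_iff.2 ⟨Or.inr ⟨e, he, hec⟩, hin₁⟩)
    · exact ⟨h₁.inl_mem_future_of_post β.occ e.2 hec, Or.inr ⟨e, he, hec⟩, hin₂⟩
  · rintro ⟨hc, hout, hin⟩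
    refine Net.mem_cut_iff.2 ⟨?_, ?_⟩
    · rcases hout with h | ⟨e, he, hec⟩
      · rcases (Net.mem_cut_iff.1 ((Net.mem_cut_iff_of_mem_future β.occ hc).2
          fun e he => h ⟨e, he⟩)).1 with h | ⟨e, he, hec⟩
        · exact Or.inl h
        · exact Or.inr ⟨e, Or.inl he, hec⟩
      · exact Or.inr ⟨e, Or.inr ⟨e, he, rfl⟩, hec⟩
    · rintro e (he | ⟨e, he, rfl⟩)
      · exact (Net.inl_mem_future.1 hc).1 e he
      · exact hin e he

theorem mem_cut_union_image_iff (I : β.FutureIso D₁ D₂) (h₁ : β.net.IsConfiguration D₁)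
    (h₂ : β.net.IsConfiguration D₂) {X : Set {e : E // Sum.inr e ∈ β.net.future D₁}}
    (c : {c : C // Sum.inl c ∈ β.net.future D₁}) :
    (I.onC c : C) ∈ β.net.cut (D₂ ∪ Subtype.val '' (I.onE '' X)) ↔
      (c : C) ∈ β.net.cut (D₁ ∪ Subtype.val '' X) := by
  rw [mem_cut_union_iff h₁, mem_cut_union_iff h₂]
  simp only [Set.exists_mem_image, Set.forall_mem_image, I.inArc_iff, I.outArc_iff,
    I.onE.surjective.forall]
  exact ⟨fun ⟨_, h⟩ => ⟨c.2, h⟩, fun ⟨_, h⟩ => ⟨(I.onC c).2, h⟩⟩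

theorem mark_union_eq (I : β.FutureIso D₁ D₂) (h₁ : β.net.IsConfiguration D₁)
    (h₂ : β.net.IsConfiguration D₂) (X : Set {e : E // Sum.inr e ∈ β.net.future D₁}) :
    β.mark (D₁ ∪ Subtype.val '' X) = β.mark (D₂ ∪ Subtype.val '' (I.onE '' X)) := by
  have hfut : ∀ {D : Set E} (_ : β.net.IsConfiguration D)
      {Y : Set {e : E // Sum.inr e ∈ β.net.future D}} {c},
      c ∈ β.net.cut (D ∪ Subtype.val '' Y) → Sum.inl c ∈ β.net.future D :=
    fun hD _ _ hc => ((mem_cut_union_iff hD).1 hc).1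
  funext p
  refine Set.ncard_congr (fun c hc => I.onC ⟨c, hfut h₁ hc.1⟩) ?_ ?_ ?_
  · intro c hc
    refine ⟨(I.mem_cut_union_image_iff h₁ h₂ _).2 hc.1, ?_⟩
    rw [I.labelC]
    exact hc.2
  · intro c d hc hd h
    exact congrArg Subtype.val (I.onC.injective (Subtype.ext h))
  · rintro d ⟨hd, rfl⟩
    obtain ⟨c, hc⟩ := I.onC.surjective ⟨d, hfut h₂ hd⟩
    have hcd : (I.onC c : C) = d := congrArg Subtype.val hc
    rw [← hcd] at hd ⊢
    exact ⟨c, ⟨(I.mem_cut_union_image_iff h₁ h₂ c).1 hd, (I.labelC c).symm⟩, rfl⟩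

end FutureIso

end BranchingProcess

/-! ### Equal markings give isomorphic futures -/

namespace BranchingProcess

variable {P : Type u₁} {T : Type u₂} {S : NetSystem P T} {C : Type v₁} {E : Type v₂}

/-- The relation `ρ` is a label-preserving bijection between the cuts of `D₁` and `D₂`. -/
structure IsCutMatching (β : BranchingProcess S C E) (D₁ D₂ : Set E) (ρ : C → C → Prop) :
    Prop where
  mem_left : ∀ {c c'}, ρ c c' → c ∈ β.net.cut D₁
  mem_right : ∀ {c c'}, ρ c c' → c' ∈ β.net.cut D₂
  label : ∀ {c c'}, ρ c c' → β.hC c = β.hC c'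
  exists_right : ∀ {c}, c ∈ β.net.cut D₁ → ∃ c', ρ c c'
  exists_left : ∀ {c'}, c' ∈ β.net.cut D₂ → ∃ c, ρ c c'
  right_unique : ∀ {c c₁ c₂}, ρ c c₁ → ρ c c₂ → c₁ = c₂
  left_unique : ∀ {c₁ c₂ c}, ρ c₁ c → ρ c₂ c → c₁ = c₂

theorem IsCutMatching.symm {β : BranchingProcess S C E} {D₁ D₂ : Set E} {ρ : C → C → Prop}
    (h : β.IsCutMatching D₁ D₂ ρ) : β.IsCutMatching D₂ D₁ (flip ρ) where
  mem_left := h.mem_right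
  mem_right := h.mem_left
  label hc := (h.label hc).symm
  exists_right := h.exists_left
  exists_left := h.exists_right
  right_unique := h.left_unique
  left_unique := h.right_unique

/-- Equal markings say that the two cuts have equally many conditions over each place; bijections
are chosen place by place. -/
theorem exists_isCutMatching [Finite P] (β : BranchingProcess S C E) {D₁ D₂ : Set E}
    (h₁ : D₁.Finite) (h₂ : D₂.Finite) (hmark : β.mark D₁ = β.mark D₂) :
    ∃ ρ, β.IsCutMatching D₁ D₂ ρ := by
  have hfib : ∀ p, ∃ f : C → C, Set.BijOn f {c | c ∈ β.net.cut D₁ ∧ β.hC c = p}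
      {c | c ∈ β.net.cut D₂ ∧ β.hC c = p} := by
    intro p
    have f₁ : {c | c ∈ β.net.cut D₁ ∧ β.hC c = p}.Finite :=
      (β.finite_cut h₁).subset fun c hc => hc.1
    have f₂ : {c | c ∈ β.net.cut D₂ ∧ β.hC c = p}.Finite :=
      (β.finite_cut h₂).subset fun c hc => hc.1
    by_cases hne : Nonempty C
    · refine f₁.exists_bijOn_of_encard_eq ?_
      rw [← f₁.cast_ncard_eq, ← f₂.cast_ncard_eq]
      exact congrArg _ (congrFun hmark p)
    · exact ⟨id, fun c => (hne ⟨c⟩).elim, fun c => (hne ⟨c⟩).elim, fun c => (hne ⟨c⟩).elim⟩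
  choose f hf using hfib
  refine ⟨fun c c' => c ∈ β.net.cut D₁ ∧ c' = f (β.hC c) c, ?_, ?_, ?_, ?_, ?_, ?_, ?_⟩
  · exact fun h => h.1
  · rintro c _ ⟨hc, rfl⟩
    exact ((hf _).mapsTo ⟨hc, rfl⟩).1
  · rintro c _ ⟨hc, rfl⟩
    exact ((hf _).mapsTo ⟨hc, rfl⟩).2.symm
  · exact fun {c} hc => ⟨_, hc, rfl⟩
  · intro c' hc'
    obtain ⟨c, ⟨hc, hcc⟩, h⟩ := (hf (β.hC c')).surjOn ⟨hc', rfl⟩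
    exact ⟨c, hc, by rw [hcc, h]⟩
  · rintro c _ _ ⟨-, rfl⟩ ⟨-, rfl⟩
    rfl
  · rintro c₁ c₂ c ⟨h₁, rfl⟩ ⟨h₂, h⟩
    have l₁ := ((hf _).mapsTo ⟨h₁, rfl⟩).2
    have l₂ := ((hf _).mapsTo ⟨h₂, rfl⟩).2
    rw [h, l₂] at l₁
    rw [← l₁] at h
    exact (hf _).injOn ⟨h₁, l₁.symm⟩ ⟨h₂, rfl⟩ h

/-- The relation between the futures of `D₁` and `D₂` generated by a relation `ρ` between their
cuts. -/
inductive FutureRel (β : BranchingProcess S C E) (D₁ D₂ : Set E) (ρ : C → C → Prop) :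
    C ⊕ E → C ⊕ E → Prop
  | cut {c c' : C} : ρ c c' → FutureRel β D₁ D₂ ρ (.inl c) (.inl c')
  | event {e e' : E} : Sum.inr e ∈ β.net.future D₁ → Sum.inr e' ∈ β.net.future D₂ →
      β.hE e = β.hE e' →
      (∀ c c', β.net.inArc c e → β.net.inArc c' e' → β.hC c = β.hC c' →
        FutureRel β D₁ D₂ ρ (.inl c) (.inl c')) →
      FutureRel β D₁ D₂ ρ (.inr e) (.inr e')
  | post {e e' : E} {c c' : C} : FutureRel β D₁ D₂ ρ (.inr e) (.inr e') → β.net.outArc e c →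
      β.net.outArc e' c' → β.hC c = β.hC c' → FutureRel β D₁ D₂ ρ (.inl c) (.inl c')

/-- Two events with the same label have input conditions with the same labels. -/
theorem exists_pre_label_eq (β : BranchingProcess S C E) {e e' : E} (h : β.hE e = β.hE e') {c : C}
    (hc : β.net.inArc c e) : ∃ c', β.net.inArc c' e' ∧ β.hC c = β.hC c' := by
  have hp := (β.bijOn_pre e).mapsTo hc
  rw [h] at hp
  obtain ⟨c', hc', h'⟩ := (β.bijOn_pre e').surjOn hp
  exact ⟨c', hc', h'.symm⟩

/-- Two events with the same label have output conditions with the same labels. -/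
theorem exists_post_label_eq (β : BranchingProcess S C E) {e e' : E} (h : β.hE e = β.hE e') {c : C}
    (hc : β.net.outArc e c) : ∃ c', β.net.outArc e' c' ∧ β.hC c = β.hC c' := by
  have hp := (β.bijOn_post e).mapsTo hc
  rw [h] at hp
  obtain ⟨c', hc', h'⟩ := (β.bijOn_post e').surjOn hp
  exact ⟨c', hc', h'.symm⟩

namespace FutureRel

variable {β : BranchingProcess S C E} {D₁ D₂ : Set E} {ρ : C → C → Prop}

/-- The generators treat both sides alike, so each one-sided property below yields its mirror image.
-/
theorem symm {x y : C ⊕ E} (h : β.FutureRel D₁ D₂ ρ x y) : β.FutureRel D₂ D₁ (flip ρ) y x := by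
  induction h with
  | cut h => exact .cut h
  | event h₁ h₂ hl _ ih => exact .event h₂ h₁ hl.symm fun c c' hc hc' h => ih c' c hc' hc h.symm
  | post _ h₁ h₂ hl ih => exact .post ih h₂ h₁ hl.symm

theorem mem_future_left (h₁ : β.net.IsConfiguration D₁) (hρ : β.IsCutMatching D₁ D₂ ρ)
    {x y : C ⊕ E} (h : β.FutureRel D₁ D₂ ρ x y) : x ∈ β.net.future D₁ := by
  induction h with
  | cut h => exact h₁.inl_mem_future_of_mem_cut β.occ (hρ.mem_left h)
  | event h _ _ _ _ => exact h
  | post _ h _ _ ih => exact h₁.inl_mem_future_of_post β.occ ih h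

theorem label_inl (hρ : β.IsCutMatching D₁ D₂ ρ) {c c' : C}
    (h : β.FutureRel D₁ D₂ ρ (.inl c) (.inl c')) : β.hC c = β.hC c' := by
  cases h with
  | cut h => exact hρ.label h
  | post _ _ _ h => exact h

theorem right_unique (h₁ : β.net.IsConfiguration D₁) (hρ : β.IsCutMatching D₁ D₂ ρ)
    {x y z : C ⊕ E} (h : β.FutureRel D₁ D₂ ρ x y) (h' : β.FutureRel D₁ D₂ ρ x z) : y = z := by
  -- The generators `cut` and `post` never apply to the same condition: a condition of the cut has
  -- no input event in the future.
  have not_cut : ∀ {e e' c c'}, β.FutureRel D₁ D₂ ρ (.inr e) (.inr e') → β.net.outArc e c →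
      ¬ ρ c c' := fun h hec hc =>
    (Net.mem_cut_iff_of_mem_future β.occ (h₁.inl_mem_future_of_mem_cut β.occ (hρ.mem_left hc))).1
      (hρ.mem_left hc) _ (h.mem_future_left h₁ hρ) hec
  induction h generalizing z with
  | cut h =>
    cases h' with
    | cut h' => rw [hρ.right_unique h h']
    | post he hec _ _ => exact (not_cut he hec h).elim
  | @event e e' he he' hl hpre ih =>
    cases h' with
    | @event _ e'' _ he'' hl' hpre' =>
      -- By irredundancy it remains to compare presets. Equally labelled inputs of `e'` and `e''`
      -- are both related to the same input of `e`, so they agree by induction.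
      refine congrArg Sum.inr (β.inj _ _ ?_ (hl.symm.trans hl'))
      ext c
      constructor
      · intro hc
        obtain ⟨d, hd, hcd⟩ := β.exists_pre_label_eq hl.symm hc
        obtain ⟨c', hc', hdc⟩ := β.exists_pre_label_eq hl' hd
        rw [Sum.inl_injective (ih d c hd hc hcd.symm (hpre' d c' hd hc' hdc))]
        exact hc'
      · intro hc
        obtain ⟨d, hd, hcd⟩ := β.exists_pre_label_eq hl'.symm hc
        obtain ⟨c', hc', hdc⟩ := β.exists_pre_label_eq hl hd
        rw [← Sum.inl_injective (ih d c' hd hc' hdc (hpre' d c hd hc hcd.symm))]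
        exact hc'
  | @post e e' c c' he hec hec' hl ih =>
    cases h' with
    | cut h' => exact (not_cut he hec h').elim
    | @post f f' _ c'' hf hfc hfc' hl' =>
      rw [β.occ.pre_subsingleton c hfc hec] at hf
      rw [← Sum.inr_injective (ih hf)] at hfc'
      rw [(β.bijOn_post e').injOn hec' hfc' (hl.symm.trans hl')]

theorem left_unique (h₂ : β.net.IsConfiguration D₂) (hρ : β.IsCutMatching D₁ D₂ ρ)
    {x y z : C ⊕ E} (h : β.FutureRel D₁ D₂ ρ x z) (h' : β.FutureRel D₁ D₂ ρ y z) : x = y :=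
  h.symm.right_unique h₂ hρ.symm h'.symm

end FutureRel

section Total

variable [Finite P] {β : BranchingProcess S C E} {D₁ D₂ : Set E} {ρ : C → C → Prop}

/-- Every finite configuration that contains `D₁` is related to a configuration that contains
`D₂`. -/
theorem IsUnfolding.exists_futureRel_configuration (hpre : ∀ t, (S.net.pre t).Nonempty)
    (hβ : β.IsUnfolding) (h₁ : β.net.IsConfiguration D₁) (h₂ : β.net.IsConfiguration D₂)
    (hρ : β.IsCutMatching D₁ D₂ ρ) {D : Set E} (hfin : D.Finite) (hD : β.net.IsConfiguration D)
    (hsub : D₁ ⊆ D) :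
    ∃ D', β.net.IsConfiguration D' ∧ D₂ ⊆ D' ∧
      (∀ c ∈ β.net.cut D, ∃ c' ∈ β.net.cut D', β.FutureRel D₁ D₂ ρ (.inl c) (.inl c')) ∧
      ∀ e ∈ D, e ∉ D₁ → ∃ e', β.FutureRel D₁ D₂ ρ (.inr e) (.inr e') := by
  -- One event is removed at a time. Carrying whole cuts along ensures that the partners of the
  -- inputs of `e` lie in a single cut, so that maximality provides the partner of `e`.
  induction hn : D.ncard generalizing D with
  | zero =>
    rw [Set.ncard_eq_zero hfin] at hn
    subst hn
    rw [Set.subset_empty_iff] at hsub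
    subst hsub
    refine ⟨D₂, h₂, subset_rfl, fun c hc => ?_, fun e he => he.elim⟩
    obtain ⟨c', hc'⟩ := hρ.exists_right hc
    exact ⟨c', hρ.mem_right hc', .cut hc'⟩
  | succ n ih =>
    rcases hsub.eq_or_ssubset with rfl | hss
    · refine ⟨D₂, h₂, subset_rfl, fun c hc => ?_, fun e he he' => (he' he).elim⟩
      obtain ⟨c', hc'⟩ := hρ.exists_right hc
      exact ⟨c', hρ.mem_right hc', .cut hc'⟩
    obtain ⟨D₀, e, hD₀, hsub₀, he, hpe, rfl⟩ := hD.exists_eq_insert β.occ hfin h₁ hss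
    have hfin₀ := hfin.subset (Set.subset_insert e D₀)
    rw [Set.ncard_insert_of_notMem he hfin₀, add_left_inj] at hn
    obtain ⟨D₀', hD₀', hsub', hcut, hevent⟩ := ih hfin₀ hD₀ hsub₀ hn
    have hB : {c' | c' ∈ β.net.cut D₀' ∧ ∃ c, β.net.inArc c e ∧
        β.FutureRel D₁ D₂ ρ (.inl c) (.inl c')} ⊆ β.net.cut D₀' := fun c hc => hc.1
    obtain ⟨e', hpe', hl⟩ := hβ.exists_event (t := β.hE e) hD₀' hB (by
      refine ⟨?_, ?_, ?_⟩
      · rintro c' ⟨-, c, hc, hcc⟩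
        rw [← hcc.label_inl hρ]
        exact (β.bijOn_pre e).mapsTo hc
      · rintro c' ⟨-, c, hc, hcc⟩ d' ⟨-, d, hd, hdd⟩ h
        rw [← hcc.label_inl hρ, ← hdd.label_inl hρ] at h
        rw [(β.bijOn_pre e).injOn hc hd h] at hcc
        exact Sum.inl_injective (hcc.right_unique h₁ hρ hdd)
      · intro p hp
        obtain ⟨c, hc, rfl⟩ := (β.bijOn_pre e).surjOn hp
        obtain ⟨c', hc', hcc⟩ := hcut c (hpe hc)
        exact ⟨c', ⟨hc', c, hc, hcc⟩, (hcc.label_inl hρ).symm⟩)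
    have hpeC : β.net.pre e' ⊆ β.net.cut D₀' := hpe' ▸ hB
    have hmem : ∀ {c'}, β.net.inArc c' e' → ∃ c, β.net.inArc c e ∧
        β.FutureRel D₁ D₂ ρ (.inl c) (.inl c') := fun {c'} hc' => by
      have : c' ∈ β.net.pre e' := hc'
      rw [hpe'] at this
      exact this.2
    have he' : e' ∉ D₀' := β.notMem_of_pre_subset_cut (hpre _) hpeC
    have hD' := hD₀'.insert_event β.occ hpeC
    have hrel : β.FutureRel D₁ D₂ ρ (.inr e) (.inr e') := by
      refine .event (Net.inr_mem_future_of_mem hD hsub (Set.mem_insert _ _) fun h => he (hsub₀ h))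
        (Net.inr_mem_future_of_mem hD' (hsub'.trans (Set.subset_insert _ _)) (Set.mem_insert _ _)
          fun h => he' (hsub' h)) hl.symm fun c c' hc hc' hcc => ?_
      obtain ⟨d, hd, hdc⟩ := hmem hc'
      rwa [(β.bijOn_pre e).injOn hc hd (hcc.trans (hdc.label_inl hρ).symm)]
    refine ⟨insert e' D₀', hD', hsub'.trans (Set.subset_insert _ _), ?_, ?_⟩
    · rw [Net.cut_insert hD₀ β.occ he, Net.cut_insert hD₀' β.occ he']
      rintro c (⟨hc, hce⟩ | hc)
      · obtain ⟨c', hc', hcc⟩ := hcut c hc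
        -- If `e'` consumed `c'`, then `c'` would be related to an input of `e`, which is `c` by
        -- left uniqueness.
        refine ⟨c', Or.inl ⟨hc', fun h => hce ?_⟩, hcc⟩
        obtain ⟨d, hd, hdc⟩ := hmem h
        rw [Sum.inl_injective (hcc.left_unique h₂ hρ hdc)]
        exact hd
      · obtain ⟨c', hc', hcc⟩ := β.exists_post_label_eq hl.symm hc
        exact ⟨c', Or.inr hc', .post hrel hc hc' hcc⟩
    · rintro f (rfl | hf) hf₁
      · exact ⟨e', hrel⟩
      · exact hevent f hf hf₁

/-- The preceding construction is applied to the finite configuration formed by `D₁` and the past of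
`e`. -/
theorem IsUnfolding.exists_futureRel_inr (hpre : ∀ t, (S.net.pre t).Nonempty)
    (hβ : β.IsUnfolding) (hfin : D₁.Finite) (h₁ : β.net.IsConfiguration D₁)
    (h₂ : β.net.IsConfiguration D₂) (hρ : β.IsCutMatching D₁ D₂ ρ) {e : E}
    (he : Sum.inr e ∈ β.net.future D₁) :
    ∃ e', β.FutureRel D₁ D₂ ρ (.inr e) (.inr e') := by
  have hpast : {f | β.net.Path (.inr f) (.inr e)}.Finite := by
    refine (β.localEvents_finite e).subset fun f hf => ?_
    rcases Relation.reflTransGen_iff_eq_or_transGen.1 hf with h | h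
    · exact Or.inr (Sum.inr_injective h).symm
    · exact Or.inl h
  obtain ⟨-, -, -, -, h⟩ := hβ.exists_futureRel_configuration hpre h₁ h₂ hρ (hfin.union hpast)
    (h₁.union_past β.occ he) Set.subset_union_left
  exact h e (Or.inr .refl) (Net.inr_mem_future.1 he).1

theorem IsUnfolding.exists_futureRel_inl (hpre : ∀ t, (S.net.pre t).Nonempty)
    (hβ : β.IsUnfolding) (hfin : D₁.Finite) (h₁ : β.net.IsConfiguration D₁)
    (h₂ : β.net.IsConfiguration D₂) (hρ : β.IsCutMatching D₁ D₂ ρ) {c : C}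
    (hc : Sum.inl c ∈ β.net.future D₁) :
    ∃ c', β.FutureRel D₁ D₂ ρ (.inl c) (.inl c') := by
  by_cases hcut : c ∈ β.net.cut D₁
  · obtain ⟨c', hc'⟩ := hρ.exists_right hcut
    exact ⟨c', .cut hc'⟩
  · rw [Net.mem_cut_iff_of_mem_future β.occ hc] at hcut
    push Not at hcut
    obtain ⟨e, he, hec⟩ := hcut
    obtain ⟨e', hee⟩ := hβ.exists_futureRel_inr hpre hfin h₁ h₂ hρ he
    have hl : β.hE e = β.hE e' := by
      cases hee with
      | event _ _ h _ => exact h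
    obtain ⟨c', hc', hcc⟩ := β.exists_post_label_eq hl hec
    exact ⟨c', .post hee hec hc' hcc⟩

end Total

/-- The equivalence of two subtypes given by a relation that is a bijection between them. -/
theorem exists_equiv_of_rel {X : Type*} {A B : Set X} (r : X → X → Prop)
    (mem_left : ∀ {x y}, r x y → x ∈ A) (mem_right : ∀ {x y}, r x y → y ∈ B)
    (exists_right : ∀ x ∈ A, ∃ y, r x y) (exists_left : ∀ y ∈ B, ∃ x, r x y)
    (right_unique : ∀ {x y z}, r x y → r x z → y = z)
    (left_unique : ∀ {x y z}, r x z → r y z → x = y) :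
    ∃ φ : {x // x ∈ A} ≃ {x // x ∈ B}, ∀ x : {x // x ∈ A}, r x (φ x) := by
  choose f hf using fun x : {x // x ∈ A} => exists_right x x.2
  choose g hg using fun x : {x // x ∈ B} => exists_left x x.2
  exact ⟨⟨fun x => ⟨f x, mem_right (hf x)⟩, fun y => ⟨g y, mem_left (hg y)⟩,
    fun x => Subtype.ext (left_unique (hg ⟨f x, mem_right (hf x)⟩) (hf x)),
    fun y => Subtype.ext (right_unique (hf ⟨g y, mem_left (hg y)⟩) (hg y))⟩, hf⟩

/-- In the unfolding, finite configurations with the same marking have isomorphic futures. -/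
theorem IsUnfolding.nonempty_futureIso [Finite P] (hpre : ∀ t, (S.net.pre t).Nonempty)
    {β : BranchingProcess S C E} (hβ : β.IsUnfolding) {D₁ D₂ : Set E} (hfin₁ : D₁.Finite)
    (hfin₂ : D₂.Finite) (h₁ : β.net.IsConfiguration D₁) (h₂ : β.net.IsConfiguration D₂)
    (hmark : β.mark D₁ = β.mark D₂) : Nonempty (β.FutureIso D₁ D₂) := by
  obtain ⟨ρ, hρ⟩ := β.exists_isCutMatching hfin₁ hfin₂ hmark
  obtain ⟨φ, hφ⟩ := exists_equiv_of_rel (A := {c | Sum.inl c ∈ β.net.future D₁})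
    (B := {c | Sum.inl c ∈ β.net.future D₂})
    (fun c c' => β.FutureRel D₁ D₂ ρ (.inl c) (.inl c'))
    (fun h => h.mem_future_left h₁ hρ) (fun h => h.symm.mem_future_left h₂ hρ.symm)
    (fun c hc => hβ.exists_futureRel_inl hpre hfin₁ h₁ h₂ hρ hc)
    (fun c hc => (hβ.exists_futureRel_inl hpre hfin₂ h₂ h₁ hρ.symm hc).imp fun _ h => h.symm)
    (fun h h' => Sum.inl_injective (h.right_unique h₁ hρ h'))
    (fun h h' => Sum.inl_injective (h.left_unique h₂ hρ h'))
  obtain ⟨ψ, hψ⟩ := exists_equiv_of_rel (A := {e | Sum.inr e ∈ β.net.future D₁})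
    (B := {e | Sum.inr e ∈ β.net.future D₂})
    (fun e e' => β.FutureRel D₁ D₂ ρ (.inr e) (.inr e'))
    (fun h => h.mem_future_left h₁ hρ) (fun h => h.symm.mem_future_left h₂ hρ.symm)
    (fun c hc => hβ.exists_futureRel_inr hpre hfin₁ h₁ h₂ hρ hc)
    (fun c hc => (hβ.exists_futureRel_inr hpre hfin₂ h₂ h₁ hρ.symm hc).imp fun _ h => h.symm)
    (fun h h' => Sum.inr_injective (h.right_unique h₁ hρ h'))
    (fun h h' => Sum.inr_injective (h.left_unique h₂ hρ h'))
  -- Stated for arbitrary configurations, so that the symmetric relation gives the converse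
  -- implication.
  have inArc_imp : ∀ {D₁ D₂ : Set E} {ρ : C → C → Prop}, β.net.IsConfiguration D₁ →
      β.IsCutMatching D₁ D₂ ρ → ∀ {c e c' e'}, β.FutureRel D₁ D₂ ρ (.inl c) (.inl c') →
      β.FutureRel D₁ D₂ ρ (.inr e) (.inr e') → β.net.inArc c e → β.net.inArc c' e' := by
    intro D₁ D₂ ρ h₁ hρ c e c' e' hc he hce
    cases he with
    | event _ _ hl hpre =>
      obtain ⟨d, hd, hcd⟩ := β.exists_pre_label_eq hl hce
      rwa [Sum.inl_injective (hc.right_unique h₁ hρ (hpre c d hce hd hcd))]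
  have outArc_imp : ∀ {D₁ D₂ : Set E} {ρ : C → C → Prop}, β.net.IsConfiguration D₁ →
      β.IsCutMatching D₁ D₂ ρ → ∀ {c e c' e'}, β.FutureRel D₁ D₂ ρ (.inl c) (.inl c') →
      β.FutureRel D₁ D₂ ρ (.inr e) (.inr e') → β.net.outArc e c → β.net.outArc e' c' := by
    intro D₁ D₂ ρ h₁ hρ c e c' e' hc he hec
    have hl : β.hE e = β.hE e' := by
      cases he with
      | event _ _ h _ => exact h
    obtain ⟨d, hd, hcd⟩ := β.exists_post_label_eq hl hec
    rwa [Sum.inl_injective (hc.right_unique h₁ hρ (.post he hec hd hcd))]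
  exact ⟨{
    onC := φ
    onE := ψ
    labelC := fun c => ((hφ c).label_inl hρ).symm
    labelE := fun e => by
      have h := hψ e
      cases h with
      | event _ _ h _ => exact h.symm
    inArc_iff := fun c e => ⟨inArc_imp h₂ hρ.symm (hφ c).symm (hψ e).symm,
      inArc_imp h₁ hρ (hφ c) (hψ e)⟩
    outArc_iff := fun e c => ⟨outArc_imp h₂ hρ.symm (hφ c).symm (hψ e).symm,
      outArc_imp h₁ hρ (hφ c) (hψ e)⟩ }⟩

end BranchingProcess

/-! ### Removing cut-off events and completeness -/

namespace BranchingProcess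

variable {P : Type u₁} {T : Type u₂} {S : NetSystem P T} {C : Type v₁} {E : Type v₂}

/-- A finite configuration that contains a cut-off event can be replaced by a smaller one with the
same marking. -/
theorem IsUnfolding.exists_prec_of_isCutoff [Finite P] (hpre : ∀ t, (S.net.pre t).Nonempty)
    {β : BranchingProcess S C E} (hβ : β.IsUnfolding) {prec : β.FinConfig → β.FinConfig → Prop}
    (hprec : β.IsAdequate prec) (D : β.FinConfig) {e : E} (heD : e ∈ D.1)
    (he : β.IsCutoff prec e) : ∃ D' : β.FinConfig, prec D' D ∧ β.mark D'.1 = β.mark D.1 := by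
  obtain ⟨e', -, hmark, hlt⟩ := he
  -- Adequacy selects an order-preserving isomorphism, possibly different from the one constructed.
  -- It leads from the future of `[e']` to that of `[e]`, so the rest of `D` is pulled back along
  -- it.
  obtain ⟨I, hI⟩ := hprec.of_extension _ _ hlt hmark.symm
    (hβ.nonempty_futureIso hpre (β.localEvents_finite e') (β.localEvents_finite e)
      (β.localEvents_isConfiguration e') (β.localEvents_isConfiguration e) hmark.symm)
  have h₁ := β.localEvents_isConfiguration e'
  have h₂ := β.localEvents_isConfiguration e
  change β.FutureIso (β.localEvents e') (β.localEvents e) at I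
  have hsub : β.localEvents e ⊆ D.1 := fun f hf => D.2.2.mem_of_path heD
    (β.path_of_mem_localEvents hf)
  let Y : Set {f : E // Sum.inr f ∈ β.net.future (β.localEvents e)} := {f | (f : E) ∈ D.1}
  have hY : D.1 = β.localEvents e ∪ Subtype.val '' Y := by
    ext f
    constructor
    · intro hf
      by_cases hfe : f ∈ β.localEvents e
      · exact Or.inl hfe
      · exact Or.inr ⟨⟨f, Net.inr_mem_future_of_mem D.2.2 hsub hf hfe⟩, hf, rfl⟩
    · rintro (hf | ⟨f, hf, rfl⟩)
      · exact hsub hf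
      · exact hf
  have hX : D.1 = β.localEvents e ∪ Subtype.val '' (I.onE '' (I.onE ⁻¹' Y)) := by
    rw [Set.image_preimage_eq Y I.onE.surjective]
    exact hY
  have hYfin : Y.Finite := D.2.1.preimage Subtype.val_injective.injOn
  have hconf : β.net.IsConfiguration (β.localEvents e' ∪ Subtype.val '' (I.onE ⁻¹' Y)) :=
    I.isConfiguration_union h₁ (hX ▸ D.2.2)
  have hfin : (β.localEvents e' ∪ Subtype.val '' (I.onE ⁻¹' Y)).Finite :=
    (β.localEvents_finite e').union ((hYfin.preimage I.onE.injective.injOn).image _)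
  refine ⟨⟨_, hfin, hconf⟩, hI (I.onE ⁻¹' Y) _ _ rfl hX, ?_⟩
  rw [hX]
  exact I.mark_union_eq h₁ h₂ _

/-- A configuration without cut-off events lies in the complete prefix. -/
theorem IsCompletePrefix.inr_mem {β : BranchingProcess S C E}
    {prec : β.FinConfig → β.FinConfig → Prop} {X : Set (C ⊕ E)} (hX : β.IsCompletePrefix prec X)
    {D : Set E} (hD : β.net.IsConfiguration D) (hcut : ∀ e ∈ D, ¬ β.IsCutoff prec e) {e : E}
    (he : e ∈ D) : Sum.inr e ∈ X := by
  -- The nodes below events of `D` form a competitor for the greatest subnet: a cut-off event below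
  -- one of them would belong to `D`.
  have hle : {x | ∃ f ∈ D, β.net.Path x (.inr f)} ⊆ X := hX.2 ⟨?_, ?_⟩
  · exact hle ⟨e, he, .refl⟩
  · rintro x ⟨f, hf, hx⟩ y hy
    exact ⟨f, hf, .head hy hx⟩
  · rintro x ⟨f, hf, hx⟩ g hg hgx
    exact hcut g (hD.mem_of_path hf (hgx.to_reflTransGen.trans hx)) hg

end BranchingProcess

end PetriUnfolding

theorem mainTheorem8 {P : Type*} {T : Type*} [Finite P] [Finite T]
    (S : PetriUnfolding.NetSystem P T)
    (hpre : ∀ t, (S.net.pre t).Nonempty)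
    {C : Type*} {E : Type*} (β : PetriUnfolding.BranchingProcess S C E)
    (hβ : β.IsUnfolding)
    (prec : β.FinConfig → β.FinConfig → Prop) (hprec : β.IsAdequate prec)
    (X : Set (C ⊕ E)) (hX : β.IsCompletePrefix prec X)
    (M : P → ℕ) (hM : S.Reachable M) :
    ∃ D : Set E, D.Finite ∧ β.net.IsConfiguration D ∧ (∀ e ∈ D, Sum.inr e ∈ X) ∧
      β.mark D = M ∧ ∀ e ∈ D, ¬ β.IsCutoff prec e := by
  obtain ⟨D₀, hfin₀, hconf₀, hmark₀⟩ := hβ.exists_mark_eq hpre hM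
  obtain ⟨D, hD, hmin⟩ := hprec.wf.has_min {D : β.FinConfig | β.mark D.1 = M}
    ⟨⟨D₀, hfin₀, hconf₀⟩, hmark₀⟩
  have hcut : ∀ e ∈ D.1, ¬ β.IsCutoff prec e := by
    intro e he hce
    obtain ⟨D', hlt, hmark⟩ := hβ.exists_prec_of_isCutoff hpre hprec D he hce
    exact hmin D' (hmark.trans hD) hlt
  exact ⟨D.1, D.2.1, D.2.2, fun e he => hX.inr_mem D.2.2 hcut he, hD, hcut⟩
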